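/- Let $\Omega\subset\mathbb R^d$ be compact, $\mu$ a Borel probability measure on $\Omega$, and $C(\Omega)$ the space of continuous real- or complex-valued functions on $\Omega$. A $\mathbf\Phi$-function is a non-decreasing function $\Phi\colon[0,\infty)\to[0,\infty)$ with $\Phi(0)=0$, $\lim_{t\to0+}\Phi(t)=0$, $\lim_{t\to\infty}\Phi(t)=\infty$ that satisfies $(\mathrm{aInc})_1$; here $\Phi\in(\mathrm{aInc})_p$ with constant $a_\Phi(p)\ge1$ means that $\Phi(s)s^{-p}\le a_\Phi(p)\,\Phi(t)t^{-p}$ for all $0<s<t$. Put $$\|f\|_\Phi=\inf\Bigl\{\lambda>0:\int_\Omega\Phi(|f|/\lambda)\,d\mu\le1\Bigr\},\qquad \|f\|_{2,\mathbf x}=\Bigl(\frac1m\sum_{j=1}^m|f(x_j)|^2\Bigr)^{1/2}\quad\text{for }\mathbf x=(x_1,\dots,x_m)\in\Omega^m.$$ **Theorem.** There are numerical constants $c_1>0$ and $C\ge1$ such that the following holds. Let $p\in[2,\infty)$, and let $\Phi$ be a $\mathbf\Phi$-function with $\Phi(1)>0$ and $\Phi\in(\mathrm{aInc})_p$ with constant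 $a_\Phi(p)$. Put $$c_2(\Phi,p)=C\,a_\Phi(p)^{2/p}\bigl(1+\Phi(1)^{-1}\bigr)^{1/p}.$$ Then for all $d$, $\Omega\subset\mathbb R^d$, $\mu$ as above, every integer $N\ge1$ and every $N$-dimensional subspace $X_N\subset C(\Omega)$, there are an integer $1\le m\le c_1N$ and points $x_1,\dots,x_m\in\Omega$ (not necessarily distinct) such that $$\|f\|_\Phi\le c_2(\Phi,p)\Bigl(\frac{\Phi(\sqrt N)}{N}\Bigr)^{1/p}\|f\|_{2,\mathbf x}\qquad\text{for all } f\in X_N.$$ -/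

import Mathlib

open Filter Topology MeasureTheory
open scoped NNReal ENNReal

noncomputable section

/-- `φ` is almost increasing on `(0, ∞)` with the constant `a ≥ 1`. -/
def AlmostIncreasingWith (a : ℝ≥0) (φ : ℝ≥0 → ℝ≥0) : Prop :=
  1 ≤ a ∧ ∀ s t : ℝ≥0, 0 < s → s < t → φ s ≤ a * φ t

/-- The condition `(aInc)_p` with the constant `a`: the function `t ↦ Φ(t) t^(-p)` is almost
increasing on `(0, ∞)` with the constant `a`. -/
def AIncWith (p : ℝ) (a : ℝ≥0) (Φ : ℝ≥0 → ℝ≥0) : Prop :=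
  AlmostIncreasingWith a (fun t => Φ t * t ^ (-p))

/-- A `Φ`-function on `[0, ∞)`: a (weakly) increasing function with `Φ(0) = 0`, `Φ(t) → 0` as
`t → 0+`, `Φ(t) → ∞` as `t → ∞`, that satisfies `(aInc)_1` with some constant. -/
structure IsPhiFunction (Φ : ℝ≥0 → ℝ≥0) : Prop where
  monotone : Monotone Φ
  map_zero : Φ 0 = 0
  tendsto_zero : Tendsto Φ (𝓝[>] 0) (𝓝 0)
  tendsto_atTop : Tendsto Φ atTop atTop
  aInc_one : ∃ a : ℝ≥0, AIncWith 1 a Φ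

/-- The modular `ρ_Φ(f) = ∫ Φ(|f|) dμ`, with values in `[0, ∞]`. -/
def orliczModular {α E : Type*} [MeasurableSpace α] [NormedAddCommGroup E]
    (Φ : ℝ≥0 → ℝ≥0) (μ : Measure α) (f : α → E) : ℝ≥0∞ :=
  ∫⁻ x, (Φ ‖f x‖₊ : ℝ≥0∞) ∂μ

/-- The Luxemburg functional `inf {r > 0 : ρ_Φ(f / r) ≤ 1}`, with values in `[0, ∞]`
(it is `∞` when there is no such `r`). -/
def luxemburgNorm {α E : Type*} [MeasurableSpace α] [NormedAddCommGroup E] [NormedSpace ℝ E]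
    (Φ : ℝ≥0 → ℝ≥0) (μ : Measure α) (f : α → E) : ℝ≥0∞ :=
  ⨅ (r : ℝ≥0) (_ : 0 < r) (_ : orliczModular Φ μ (fun x => (r : ℝ)⁻¹ • f x) ≤ 1), (r : ℝ≥0∞)

/-- The discrete `L²`-norm `(1/m ∑_j |f(x_j)|²)^(1/2)` for the points `x_1, …, x_m`
(equal weights, a repeated point is counted with its multiplicity). -/
def discreteL2Norm {α E : Type*} [NormedAddCommGroup E] {m : ℕ} (x : Fin m → α) (f : α → E) : ℝ :=
  Real.sqrt ((1 / (m : ℝ)) * ∑ j, ‖f (x j)‖ ^ 2)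

end

/- The points are the union of two samples of `O(N)` points. A sample that maximizes the Gram
determinant of a basis of `X` has small leverage scores at every point of `Ω`, because exchanging
one sample point for another point cannot increase the determinant; this bounds the supremum norm
on `X` by `√N` times the discrete norm. A one-sided barrier argument in the style of Batson,
Spielman and Srivastava, applied to an orthonormal basis of the image of `X` in `L²(μ)`, yields a
sample whose discrete norm dominates the norm of `L²(μ)`. Finally, `(aInc)_p` with `p ≥ 2` gives
`Φ(s / Λ) ≤ s²` for all `s ≤ √N` when `Λ` is the constant of the theorem, so that `‖f‖_∞ ≤ K √N`
and `‖f‖_2 ≤ K` imply `‖f‖_Φ ≤ Λ K`. -/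

open Matrix
open scoped ComplexOrder

/-- The frame operator `∑ⱼ vⱼ* vⱼ` of a finite family of row vectors `vⱼ`, so that
`c* (frameMatrix v) c = ∑ⱼ |vⱼ c|²`. -/
def frameMatrix {κ n 𝕜 : Type*} [Fintype κ] [RCLike 𝕜] (v : κ → n → 𝕜) : Matrix n n 𝕜 :=
  ∑ j, vecMulVec (star (v j)) (v j)

/-- The leverage score `v S⁻¹ v*` of the row vector `v` with respect to `S`. It is meant for a
positive definite `S`, where this number is real. -/
noncomputable def leverage {n 𝕜 : Type*} [Fintype n] [DecidableEq n] [RCLike 𝕜] (S : Matrix n n 𝕜)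
    (v : n → 𝕜) : ℝ :=
  RCLike.re (v ⬝ᵥ (S⁻¹ *ᵥ star v))

section LinearAlgebra

variable {κ n 𝕜 : Type*} [RCLike 𝕜]

theorem posSemidef_frameMatrix [Fintype κ] [Finite n] (v : κ → n → 𝕜) :
    (frameMatrix v).PosSemidef :=
  posSemidef_sum _ fun j _ => posSemidef_vecMulVec_star_self (v j)

variable [Fintype n]

theorem star_dotProduct_vecMulVec_mulVec (v c : n → 𝕜) :
    star c ⬝ᵥ (vecMulVec (star v) v *ᵥ c) = ((‖v ⬝ᵥ c‖ ^ 2 : ℝ) : 𝕜) := by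
  rw [vecMulVec_mulVec, dotProduct_smul, star_dotProduct_star, op_smul_eq_mul,
    RCLike.star_def, RCLike.conj_mul, RCLike.ofReal_pow]

theorem star_dotProduct_frameMatrix_mulVec [Fintype κ] (v : κ → n → 𝕜) (c : n → 𝕜) :
    star c ⬝ᵥ (frameMatrix v *ᵥ c) = ((∑ j, ‖v j ⬝ᵥ c‖ ^ 2 : ℝ) : 𝕜) := by
  simp only [frameMatrix, sum_mulVec, dotProduct_sum, star_dotProduct_vecMulVec_mulVec,
    RCLike.ofReal_sum]

theorem posDef_frameMatrix [Fintype κ] {v : κ → n → 𝕜}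
    (hv : ∀ c, (∀ j, v j ⬝ᵥ c = 0) → c = 0) : (frameMatrix v).PosDef := by
  refine .of_dotProduct_mulVec_pos (posSemidef_frameMatrix v).isHermitian fun c hc => ?_
  rw [star_dotProduct_frameMatrix_mulVec, RCLike.ofReal_pos]
  refine (Finset.sum_nonneg fun j _ => sq_nonneg _).lt_of_ne' fun h0 => hc (hv c fun j => ?_)
  simpa using (Finset.sum_eq_zero_iff_of_nonneg fun j _ => sq_nonneg ‖v j ⬝ᵥ c‖).1 h0 j
    (Finset.mem_univ j)

variable [DecidableEq n]

theorem leverage_nonneg {S : Matrix n n 𝕜} (hS : S.PosDef) (v : n → 𝕜) : 0 ≤ leverage S v := by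
  simpa [leverage] using hS.inv.posSemidef.re_dotProduct_nonneg (star v)

theorem ofReal_leverage {S : Matrix n n 𝕜} (hS : S.PosDef) (v : n → 𝕜) :
    (leverage S v : 𝕜) = v ⬝ᵥ (S⁻¹ *ᵥ star v) := by
  have him := hS.inv.isHermitian.im_star_dotProduct_mulVec_self (star v)
  rw [star_star] at him
  apply RCLike.ext <;> simp [leverage, him]

theorem norm_sq_dotProduct_le_leverage_mul {S : Matrix n n 𝕜} (hS : S.PosDef) (v c : n → 𝕜) :
    ‖v ⬝ᵥ c‖ ^ 2 ≤ leverage S v * RCLike.re (star c ⬝ᵥ (S *ᵥ c)) := by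
  have hdet : IsUnit S.det := (isUnit_iff_isUnit_det S).1 hS.isUnit
  have hinv : S *ᵥ (S⁻¹ *ᵥ star v) = star v := by
    rw [mulVec_mulVec, mul_nonsing_inv _ hdet, one_mulVec]
  -- Cauchy–Schwarz for the inner product induced by `S`, applied to `c` and `S⁻¹ v*`.
  let := S.toSeminormedAddCommGroup hS.posSemidef
  let := S.toInnerProductSpace hS.posSemidef
  have hinner (x y : n → 𝕜) : inner 𝕜 x y = (S *ᵥ y) ⬝ᵥ star x := rfl
  have hcs := inner_mul_inner_self_le (𝕜 := 𝕜) c (S⁻¹ *ᵥ star v)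
  rw [norm_inner_symm (𝕜 := 𝕜) (S⁻¹ *ᵥ star v) c, ← sq] at hcs
  simp only [hinner, hinv] at hcs
  rw [star_dotProduct_star, norm_star, dotProduct_comm (S *ᵥ c), star_dotProduct_star,
    RCLike.star_def, RCLike.conj_re] at hcs
  rwa [mul_comm, leverage, dotProduct_comm v, dotProduct_comm v]

theorem det_add_vecMulVec {S : Matrix n n 𝕜} (hS : S.PosDef) (r : ℝ) (v : n → 𝕜) :
    (S + r • vecMulVec (star v) v).det = S.det * ((1 + r * leverage S v : ℝ) : 𝕜) := by
  have hdet : IsUnit S.det := (isUnit_iff_isUnit_det S).1 hS.isUnit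
  have h := det_add_mul (replicateCol Unit ((r : 𝕜) • star v)) (replicateRow Unit v) hdet
  rw [← vecMulVec_eq, smul_vecMulVec, Matrix.mul_assoc, ← replicateCol_mulVec,
    det_unique (n := Unit), Matrix.add_apply, one_apply_eq, replicateRow_mul_replicateCol_apply,
    mulVec_smul, dotProduct_smul, smul_eq_mul, ← ofReal_leverage hS] at h
  rw [RCLike.real_smul_eq_coe_smul (K := 𝕜), h]
  push_cast
  rfl

theorem sum_leverage_frameMatrix [Fintype κ] {v : κ → n → 𝕜} (hv : (frameMatrix v).PosDef) :
    ∑ j, leverage (frameMatrix v) (v j) = Fintype.card n := by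
  have hdet : IsUnit (frameMatrix v).det := (isUnit_iff_isUnit_det _).1 hv.isUnit
  have htr (j : κ) : leverage (frameMatrix v) (v j)
      = RCLike.re ((frameMatrix v)⁻¹ * vecMulVec (star (v j)) (v j)).trace := by
    rw [leverage, mul_vecMulVec, trace_vecMulVec, dotProduct_comm]
  calc ∑ j, leverage (frameMatrix v) (v j)
      = RCLike.re ((frameMatrix v)⁻¹ * ∑ j, vecMulVec (star (v j)) (v j)).trace := by
        simp only [htr, Finset.mul_sum, trace_sum, map_sum]
    _ = RCLike.re (1 : Matrix n n 𝕜).trace := by rw [← frameMatrix, nonsing_inv_mul _ hdet]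
    _ = Fintype.card n := by rw [trace_one, RCLike.natCast_re]

theorem inv_add_vecMulVec {S : Matrix n n 𝕜} (hS : S.PosDef) (v : n → 𝕜) :
    (S + vecMulVec (star v) v)⁻¹ =
      S⁻¹ - (1 + leverage S v)⁻¹ • vecMulVec (S⁻¹ *ᵥ star v) (v ᵥ* S⁻¹) := by
  have hdet : IsUnit S.det := (isUnit_iff_isUnit_det S).1 hS.isUnit
  have hl : 1 + leverage S v ≠ 0 := by linarith [leverage_nonneg hS v]
  set W := vecMulVec (star v) (v ᵥ* S⁻¹)
  have hSW : S * vecMulVec (S⁻¹ *ᵥ star v) (v ᵥ* S⁻¹) = W := by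
    rw [mul_vecMulVec, mulVec_mulVec, mul_nonsing_inv _ hdet, one_mulVec]
  have hvW : vecMulVec (star v) v * vecMulVec (S⁻¹ *ᵥ star v) (v ᵥ* S⁻¹) = leverage S v • W := by
    rw [vecMulVec_mul_vecMulVec, ← ofReal_leverage hS, vecMulVec_smul,
      RCLike.real_smul_eq_coe_smul (K := 𝕜)]
  apply inv_eq_right_inv
  calc (S + vecMulVec (star v) v) *
        (S⁻¹ - (1 + leverage S v)⁻¹ • vecMulVec (S⁻¹ *ᵥ star v) (v ᵥ* S⁻¹))
      = 1 + W - (1 + leverage S v)⁻¹ • ((1 + leverage S v) • W) := by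
        rw [mul_sub, add_mul, Matrix.mul_smul, add_mul, hSW, hvW, mul_nonsing_inv _ hdet,
          vecMulVec_mul, add_smul, one_smul]
    _ = 1 := by rw [smul_smul, inv_mul_cancel₀ hl, one_smul, add_sub_cancel_right]

theorem re_trace_inv_add_vecMulVec {S : Matrix n n 𝕜} (hS : S.PosDef) (v : n → 𝕜) :
    RCLike.re (S + vecMulVec (star v) v)⁻¹.trace =
      RCLike.re S⁻¹.trace - RCLike.re (v ⬝ᵥ (S⁻¹ ^ 2 *ᵥ star v)) / (1 + leverage S v) := by
  rw [inv_add_vecMulVec hS, trace_sub, trace_smul, trace_vecMulVec, map_sub, RCLike.smul_re,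
    dotProduct_comm, ← dotProduct_mulVec, mulVec_mulVec, ← sq, div_eq_inv_mul]

end LinearAlgebra

section OptimalDesign

variable {n 𝕜 : Type*} [RCLike 𝕜]

theorem frameMatrix_eq_succAbove_add {m : ℕ} (v : Fin (m + 1) → n → 𝕜) (i : Fin (m + 1)) :
    frameMatrix v = frameMatrix (v ∘ i.succAbove) + vecMulVec (star (v i)) (v i) := by
  rw [frameMatrix, Fin.sum_univ_succAbove _ i, add_comm]
  rfl

variable [Fintype n]

theorem exists_posDef_frameMatrix {Ω : Type*} [Nonempty Ω] {e : Ω → n → 𝕜}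
    (he : ∀ c, (∀ y, e y ⬝ᵥ c = 0) → c = 0) {m : ℕ} (hm : Fintype.card n ≤ m) :
    ∃ x : Fin m → Ω, (frameMatrix (e ∘ x)).PosDef := by
  obtain ⟨v, hv, hspan, -⟩ := Submodule.exists_fun_fin_finrank_span_eq 𝕜 (Set.range e)
  choose z hz using hv
  have hrank : Module.finrank 𝕜 (Submodule.span 𝕜 (Set.range e)) ≤ m :=
    (Submodule.finrank_le _).trans (by simpa using hm)
  refine ⟨Function.extend (Fin.castLE hrank) z fun _ => Classical.arbitrary Ω,
    posDef_frameMatrix fun c hc => he c fun y => ?_⟩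
  have hzero : ∀ w ∈ Submodule.span 𝕜 (Set.range v), w ⬝ᵥ c = 0 := fun w hw => by
    induction hw using Submodule.span_induction with
    | mem _ h =>
      obtain ⟨i, rfl⟩ := h
      simpa [(Fin.castLE_injective hrank).extend_apply, hz] using hc (Fin.castLE hrank i)
    | zero => exact zero_dotProduct c
    | add _ _ _ _ h₁ h₂ => rw [add_dotProduct, h₁, h₂, add_zero]
    | smul r _ _ h => rw [smul_dotProduct, h, smul_zero]
  exact hzero _ (hspan.ge <| Submodule.subset_span (Set.mem_range_self y))

variable [DecidableEq n]

theorem sum_det_frameMatrix_succAbove {m : ℕ} {v : Fin (m + 1) → n → 𝕜}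
    (hv : (frameMatrix v).PosDef) :
    ∑ i : Fin (m + 1), (frameMatrix (v ∘ i.succAbove)).det =
      (frameMatrix v).det * ((m + 1 - Fintype.card n : ℝ) : 𝕜) := by
  have hdet (i : Fin (m + 1)) : (frameMatrix (v ∘ i.succAbove)).det =
      (frameMatrix v).det * ((1 + -1 * leverage (frameMatrix v) (v i) : ℝ) : 𝕜) := by
    rw [← det_add_vecMulVec hv, neg_one_smul, ← sub_eq_add_neg,
      sub_eq_of_eq_add (frameMatrix_eq_succAbove_add v i)]
  simp only [hdet, ← Finset.mul_sum, ← RCLike.ofReal_sum, Finset.sum_add_distrib,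
    sum_leverage_frameMatrix hv, Finset.sum_const, Finset.card_univ, Fintype.card_fin,
    nsmul_eq_mul]
  push_cast
  ring

theorem leverage_le_of_exchange {m : ℕ} {v : Fin m → n → 𝕜} (hv : (frameMatrix v).PosDef)
    {u : n → 𝕜}
    (hopt : ∀ i : Fin (m + 1), RCLike.re (frameMatrix (Fin.cons u v ∘ i.succAbove)).det ≤
      RCLike.re (frameMatrix v).det) :
    (m + 1 - Fintype.card n) * leverage (frameMatrix v) u ≤ Fintype.card n := by
  set S := frameMatrix v
  set S' := frameMatrix (Fin.cons u v : Fin (m + 1) → n → 𝕜)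
  have hS' : S' = S + (1 : ℝ) • vecMulVec (star u) u := by
    rw [one_smul]
    exact frameMatrix_eq_succAbove_add (Fin.cons u v : Fin (m + 1) → n → 𝕜) 0
  have hdet : RCLike.re S'.det = RCLike.re S.det * (1 + leverage S u) := by
    rw [hS', det_add_vecMulVec hv, RCLike.re_mul_ofReal, one_mul]
  have hS'pos : S'.PosDef := by
    rw [hS', one_smul]
    exact hv.add_posSemidef (posSemidef_vecMulVec_star_self u)
  have hSdet : 0 < RCLike.re S.det := (RCLike.pos_iff.1 hv.det_pos).1
  have hsum : RCLike.re S'.det * (m + 1 - Fintype.card n) ≤ (m + 1) * RCLike.re S.det := by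
    -- Averaging over the exchanged row: all the determinants in the sum are at most `S.det`.
    rw [← RCLike.re_mul_ofReal (K := 𝕜), ← sum_det_frameMatrix_succAbove hS'pos, map_sum]
    simpa using Finset.sum_le_sum fun i (_ : i ∈ Finset.univ) => hopt i
  rw [hdet] at hsum
  have hcancel : (1 + leverage S u) * (m + 1 - Fintype.card n) ≤ m + 1 :=
    le_of_mul_le_mul_left (by linarith) hSdet
  linarith

theorem exists_leverage_le {Ω : Type*} [TopologicalSpace Ω] [CompactSpace Ω] [Nonempty Ω]
    {e : Ω → n → 𝕜} (he : Continuous e) (hsep : ∀ c, (∀ y, e y ⬝ᵥ c = 0) → c = 0) {m : ℕ}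
    (hm : Fintype.card n ≤ m) :
    ∃ x : Fin m → Ω, (frameMatrix (e ∘ x)).PosDef ∧
      ∀ y, (m + 1 - Fintype.card n) * leverage (frameMatrix (e ∘ x)) (e y) ≤ Fintype.card n := by
  let D (x : Fin m → Ω) : ℝ := RCLike.re (frameMatrix (e ∘ x)).det
  have hD : Continuous D := by
    unfold D frameMatrix
    fun_prop
  obtain ⟨x, -, hx⟩ := isCompact_univ.exists_isMaxOn Set.univ_nonempty hD.continuousOn
  obtain ⟨z, hz⟩ := exists_posDef_frameMatrix hsep hm
  have hxpos : (frameMatrix (e ∘ x)).PosDef := by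
    have hdet : (frameMatrix (e ∘ x)).det ≠ 0 := fun h0 =>
      (RCLike.pos_iff.1 hz.det_pos).1.not_ge (by simpa [D, h0] using hx (Set.mem_univ z))
    exact (posSemidef_frameMatrix _).posDef_iff_isUnit.2
      ((isUnit_iff_isUnit_det _).2 hdet.isUnit)
  refine ⟨x, hxpos, fun y => leverage_le_of_exchange hxpos fun i => ?_⟩
  rw [← Fin.comp_cons, Function.comp_assoc]
  exact hx (Set.mem_univ _)

theorem exists_points_norm_sq_le_sum {Ω 𝕜 : Type*} [RCLike 𝕜] [TopologicalSpace Ω] [CompactSpace Ω]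
    [Nonempty Ω] (X : Submodule 𝕜 C(Ω, 𝕜)) [Module.Finite 𝕜 X] {m : ℕ}
    (hm : Module.finrank 𝕜 X ≤ m) :
    ∃ x : Fin m → Ω, ∀ f ∈ X, ∀ y, (m + 1 - Module.finrank 𝕜 X) * ‖f y‖ ^ 2 ≤
      Module.finrank 𝕜 X * ∑ j, ‖f (x j)‖ ^ 2 := by
  let b := Module.finBasis 𝕜 X
  let e (y : Ω) (i : Fin (Module.finrank 𝕜 X)) : 𝕜 := (b i : C(Ω, 𝕜)) y
  have he : Continuous e := continuous_pi fun i => (b i : C(Ω, 𝕜)).continuous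
  have heval (f : X) (y : Ω) : e y ⬝ᵥ b.repr f = (f : C(Ω, 𝕜)) y := by
    have hf : ∑ i, b.repr f i • (b i : C(Ω, 𝕜)) = f := by
      exact_mod_cast congrArg Subtype.val (b.sum_repr f)
    rw [← hf, ContinuousMap.sum_apply]
    simp [dotProduct, e, mul_comm]
  have hsep (c) (hc : ∀ y, e y ⬝ᵥ c = 0) : c = 0 := by
    have h0 : b.equivFun.symm c = 0 := by
      ext y
      rw [← heval, ← b.equivFun_apply, b.equivFun.apply_symm_apply, hc y]
      rfl
    rwa [LinearEquiv.map_eq_zero_iff] at h0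
  obtain ⟨x, hpos, hx⟩ := exists_leverage_le he hsep (by simpa using hm)
  rw [Fintype.card_fin] at hx
  refine ⟨x, fun f hf y => ?_⟩
  have hcs := norm_sq_dotProduct_le_leverage_mul hpos (e y) (b.repr ⟨f, hf⟩)
  simp only [star_dotProduct_frameMatrix_mulVec, RCLike.ofReal_re, Function.comp_apply, heval]
    at hcs
  have hcast : (Module.finrank 𝕜 X : ℝ) ≤ m := by exact_mod_cast hm
  calc (m + 1 - Module.finrank 𝕜 X) * ‖f y‖ ^ 2
      ≤ (m + 1 - Module.finrank 𝕜 X) *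
          (leverage (frameMatrix (e ∘ x)) (e y) * ∑ j, ‖f (x j)‖ ^ 2) := by
        gcongr
        linarith
    _ ≤ Module.finrank 𝕜 X * ∑ j, ‖f (x j)‖ ^ 2 := by
        rw [← mul_assoc]
        gcongr
        exact hx y

end OptimalDesign

section BarrierSelection

theorem sum_sub_sum_mul_one_add_sum_le {ι : Type*} [Fintype ι] {y z : ι → ℝ} (hy : ∀ i, 0 ≤ y i)
    (hz : ∀ i, 0 ≤ z i) (hyz : ∀ i, y i - z i = y i * z i / 2) (hsum : ∑ i, z i ≤ 1) :
    (∑ i, y i - ∑ i, z i) * (1 + ∑ i, y i) ≤ ∑ i, y i ^ 2 := by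
  have hyz0 : 0 ≤ ∑ i, y i * z i := Finset.sum_nonneg fun i _ => mul_nonneg (hy i) (hz i)
  have hyyz0 : 0 ≤ ∑ i, y i ^ 2 * z i :=
    Finset.sum_nonneg fun i _ => mul_nonneg (sq_nonneg _) (hz i)
  have hdiff : ∑ i, y i - ∑ i, z i = (∑ i, y i * z i) / 2 := by
    simp only [← Finset.sum_sub_distrib, hyz, Finset.sum_div]
  have hsq : ∑ i, y i ^ 2 = ∑ i, y i * z i + (∑ i, y i ^ 2 * z i) / 2 := by
    rw [Finset.sum_div, ← Finset.sum_add_distrib]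
    exact Finset.sum_congr rfl fun i _ => by linear_combination y i * hyz i
  have hcs : (∑ i, y i * z i) ^ 2 ≤ (∑ i, y i ^ 2 * z i) * ∑ i, z i :=
    Finset.sum_sq_le_sum_mul_sum_of_sq_le_mul _ (fun i _ => mul_nonneg (sq_nonneg _) (hz i))
      (fun i _ => hz i) fun i _ => by rw [mul_pow, sq (z i), mul_assoc]
  calc (∑ i, y i - ∑ i, z i) * (1 + ∑ i, y i)
      ≤ (∑ i, y i * z i) / 2 * (2 + (∑ i, y i * z i) / 2) := by
        rw [hdiff]
        exact mul_le_mul_of_nonneg_left (by linarith) (by linarith)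
    _ = ∑ i, y i * z i + (∑ i, y i * z i) ^ 2 / 4 := by ring
    _ ≤ ∑ i, y i * z i + (∑ i, y i ^ 2 * z i) / 2 := by
        linarith [hcs.trans (mul_le_of_le_one_right hyyz0 hsum)]
    _ = ∑ i, y i ^ 2 := hsq.symm

section Matrices

variable {n 𝕜 : Type*} [RCLike 𝕜] [Fintype n] [DecidableEq n]

theorem sub_smul_one_eq_conj_diagonal {H : Matrix n n 𝕜} (hH : H.IsHermitian) (s : ℝ) :
    H - s • (1 : Matrix n n 𝕜) = Unitary.conjStarAlgAut 𝕜 _ hH.eigenvectorUnitary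
      (diagonal fun i => ((hH.eigenvalues i - s : ℝ) : 𝕜)) := by
  have hdiag : (diagonal fun i => ((hH.eigenvalues i - s : ℝ) : 𝕜)) =
      diagonal (RCLike.ofReal ∘ hH.eigenvalues) - (s : 𝕜) • (1 : Matrix n n 𝕜) := by
    simp only [smul_one_eq_diagonal, diagonal_sub, RCLike.ofReal_sub, Function.comp_apply]
  rw [hdiag, map_sub, map_smul, map_one, ← hH.spectral_theorem,
    RCLike.real_smul_eq_coe_smul (K := 𝕜)]

theorem posDef_sub_smul_one {H : Matrix n n 𝕜} (hH : H.IsHermitian) {s : ℝ}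
    (hs : ∀ i, s < hH.eigenvalues i) : (H - s • (1 : Matrix n n 𝕜)).PosDef := by
  rw [sub_smul_one_eq_conj_diagonal hH, Unitary.conjStarAlgAut_apply,
    Unitary.isUnit_coe.posDef_star_right_conjugate_iff, posDef_diagonal_iff]
  exact fun i => RCLike.ofReal_pos.2 (sub_pos.2 (hs i))

theorem re_trace_inv_sub_smul_one_pow {H : Matrix n n 𝕜} (hH : H.IsHermitian) {s : ℝ}
    (hs : ∀ i, s < hH.eigenvalues i) (k : ℕ) :
    RCLike.re ((H - s • (1 : Matrix n n 𝕜))⁻¹ ^ k).trace =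
      ∑ i, (hH.eigenvalues i - s)⁻¹ ^ k := by
  set U := hH.eigenvectorUnitary
  have hinv : (H - s • (1 : Matrix n n 𝕜))⁻¹ = Unitary.conjStarAlgAut 𝕜 _ U
      (diagonal fun i => (((hH.eigenvalues i - s)⁻¹ : ℝ) : 𝕜)) := by
    apply inv_eq_right_inv
    rw [sub_smul_one_eq_conj_diagonal hH, ← map_mul, diagonal_mul_diagonal, ← map_one
      (Unitary.conjStarAlgAut 𝕜 _ U), ← diagonal_one]
    congr 2
    ext i
    rw [← RCLike.ofReal_mul, mul_inv_cancel₀ (sub_pos.2 (hs i)).ne', RCLike.ofReal_one]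
  rw [hinv, ← map_pow, diagonal_pow, Unitary.conjStarAlgAut_apply, trace_mul_cycle,
    Unitary.coe_star_mul_self, one_mul, trace_diagonal, map_sum]
  simp only [Pi.pow_apply, ← RCLike.ofReal_pow, RCLike.ofReal_re]

theorem one_le_eigenvalues_of_re_trace_inv_le_one {H : Matrix n n 𝕜} (hH : H.PosDef)
    (htr : RCLike.re H⁻¹.trace ≤ 1) (i : n) : 1 ≤ hH.isHermitian.eigenvalues i := by
  have hpos := hH.eigenvalues_pos
  have h := re_trace_inv_sub_smul_one_pow hH.isHermitian (s := 0) hpos 1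
  simp only [zero_smul, sub_zero, pow_one] at h
  rw [h] at htr
  refine (inv_le_one₀ (hpos i)).1 (htr.trans' ?_)
  exact Finset.single_le_sum (fun j _ => (inv_pos.2 (hpos j)).le) (Finset.mem_univ i)

theorem re_trace_sub_re_trace_mul_le {H : Matrix n n 𝕜} (hH : H.PosDef)
    (htr : RCLike.re H⁻¹.trace ≤ 1) {Y : Matrix n n 𝕜}
    (hY : Y = (H - (2⁻¹ : ℝ) • (1 : Matrix n n 𝕜))⁻¹) :
    (RCLike.re Y.trace - RCLike.re H⁻¹.trace) * (1 + RCLike.re Y.trace) ≤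
      RCLike.re (Y ^ 2).trace := by
  set l := hH.isHermitian.eigenvalues
  have hl (i : n) : 1 ≤ l i := one_le_eigenvalues_of_re_trace_inv_le_one hH htr i
  have hl0 (i : n) : 0 < l i := zero_lt_one.trans_le (hl i)
  have hl2 (i : n) : 2⁻¹ < l i := by linarith [hl i]
  have hZtr : RCLike.re H⁻¹.trace = ∑ i, (l i)⁻¹ := by
    simpa using re_trace_inv_sub_smul_one_pow hH.isHermitian hl0 1
  have hYtr : RCLike.re Y.trace = ∑ i, (l i - 2⁻¹)⁻¹ := by
    simpa [hY] using re_trace_inv_sub_smul_one_pow hH.isHermitian hl2 1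
  rw [hZtr, hYtr, hY, re_trace_inv_sub_smul_one_pow hH.isHermitian hl2]
  refine sum_sub_sum_mul_one_add_sum_le (fun i => inv_nonneg.2 (sub_pos.2 (hl2 i)).le)
    (fun i => (inv_pos.2 (hl0 i)).le) (fun i => ?_) (hZtr ▸ htr)
  rw [inv_sub_inv (sub_pos.2 (hl2 i)).ne' (hl0 i).ne', sub_sub_cancel, ← mul_inv,
    div_eq_inv_mul, div_eq_mul_inv]

theorem exists_barrier_step {H : Matrix n n 𝕜} (hH : H.PosDef) (htr : RCLike.re H⁻¹.trace ≤ 1)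
    {ι : Type*} {w : ι → n → 𝕜} (hw : ∀ B : Matrix n n 𝕜, B.IsHermitian →
      ∃ x, RCLike.re B.trace ≤ RCLike.re (w x ⬝ᵥ (B *ᵥ star (w x)))) :
    ∃ x, (H - (2⁻¹ : ℝ) • (1 : Matrix n n 𝕜) + vecMulVec (star (w x)) (w x)).PosDef ∧
      RCLike.re (H - (2⁻¹ : ℝ) • (1 : Matrix n n 𝕜) + vecMulVec (star (w x)) (w x))⁻¹.trace
        ≤ 1 := by
  set R := H - (2⁻¹ : ℝ) • (1 : Matrix n n 𝕜)
  have hR : R.PosDef := posDef_sub_smul_one hH.isHermitian fun i =>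
    (by norm_num : (2⁻¹ : ℝ) < 1).trans_le (one_le_eigenvalues_of_re_trace_inv_le_one hH htr i)
  set T := RCLike.re R⁻¹.trace - RCLike.re H⁻¹.trace
  have hbarrier : T * (1 + RCLike.re R⁻¹.trace) ≤ RCLike.re (R⁻¹ ^ 2).trace :=
    re_trace_sub_re_trace_mul_le hH htr rfl
  -- With this choice of `B`, its trace inequality says that adding the rank-one matrix of `w x`
  -- lowers the trace of the inverse by at least the amount `T` by which the shift has raised it.
  obtain ⟨x, hx⟩ := hw (R⁻¹ ^ 2 - T • R⁻¹)
    ((hR.inv.isHermitian.pow 2).sub (hR.inv.isHermitian.smul (star_trivial T)))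
  rw [trace_sub, trace_smul, sub_mulVec, dotProduct_sub, smul_mulVec, dotProduct_smul, map_sub,
    map_sub, RCLike.smul_re, RCLike.smul_re, ← leverage] at hx
  refine ⟨x, hR.add_posSemidef (posSemidef_vecMulVec_star_self _), ?_⟩
  have hl : 0 < 1 + leverage R (w x) := by linarith [leverage_nonneg hR (w x)]
  have hdrop : T ≤ RCLike.re (w x ⬝ᵥ (R⁻¹ ^ 2 *ᵥ star (w x))) / (1 + leverage R (w x)) := by
    rw [le_div_iff₀ hl]
    linarith
  rw [re_trace_inv_add_vecMulVec hR]
  linarith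

theorem exists_barrier_points {ι : Type*} {w : ι → n → 𝕜}
    (hw : ∀ B : Matrix n n 𝕜, B.IsHermitian →
      ∃ x, RCLike.re B.trace ≤ RCLike.re (w x ⬝ᵥ (B *ᵥ star (w x))))
    {t : ℝ} (ht : 0 < t) (hcard : Fintype.card n ≤ t) (m : ℕ) :
    ∃ x : Fin m → ι, (frameMatrix (w ∘ x) + (t - m / 2) • (1 : Matrix n n 𝕜)).PosDef ∧
      RCLike.re (frameMatrix (w ∘ x) + (t - m / 2) • (1 : Matrix n n 𝕜))⁻¹.trace ≤ 1 := by
  induction m with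
  | zero =>
    have hinv : (t • (1 : Matrix n n 𝕜))⁻¹ = t⁻¹ • (1 : Matrix n n 𝕜) := by
      apply inv_eq_right_inv
      rw [smul_mul_smul_comm, one_mul, mul_inv_cancel₀ ht.ne', one_smul]
    refine ⟨Fin.elim0, ?_⟩
    simp only [frameMatrix, Finset.univ_eq_empty, Finset.sum_empty, zero_add, Nat.cast_zero,
      zero_div, sub_zero]
    refine ⟨PosDef.one.smul ht, ?_⟩
    rw [hinv, trace_smul, trace_one, RCLike.smul_re, RCLike.natCast_re]
    exact inv_mul_le_one_of_le₀ hcard ht.le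
  | succ m ih =>
    obtain ⟨x, hx, htr⟩ := ih
    obtain ⟨y, hy⟩ := exists_barrier_step hx htr hw
    have hframe : frameMatrix (w ∘ (Fin.cons y x : Fin (m + 1) → ι)) =
        frameMatrix (w ∘ x) + vecMulVec (star (w y)) (w y) :=
      frameMatrix_eq_succAbove_add _ 0
    have hshift : frameMatrix (w ∘ (Fin.cons y x : Fin (m + 1) → ι)) +
          (t - (m + 1 : ℕ) / 2) • (1 : Matrix n n 𝕜) =
        frameMatrix (w ∘ x) + (t - m / 2) • (1 : Matrix n n 𝕜) -
          (2⁻¹ : ℝ) • (1 : Matrix n n 𝕜) + vecMulVec (star (w y)) (w y) := by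
      rw [hframe]
      push_cast
      module
    exact ⟨Fin.cons y x, hshift ▸ hy⟩

end Matrices

theorem exists_points_mul_sum_norm_sq_le {ι n 𝕜 : Type*} [RCLike 𝕜] [Fintype n] {w : ι → n → 𝕜}
    (hw : ∀ B : Matrix n n 𝕜, B.IsHermitian →
      ∃ x, RCLike.re B.trace ≤ RCLike.re (w x ⬝ᵥ (B *ᵥ star (w x))))
    {t : ℝ} (ht : 0 < t) (hcard : Fintype.card n ≤ t) (m : ℕ) :
    ∃ x : Fin m → ι, ∀ c : n → 𝕜,
      (m / 2 - t) * ∑ i, ‖c i‖ ^ 2 ≤ ∑ j, ‖w (x j) ⬝ᵥ c‖ ^ 2 := by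
  classical
  obtain ⟨x, hx, -⟩ := exists_barrier_points hw ht hcard m
  refine ⟨x, fun c => ?_⟩
  have hone : star c ⬝ᵥ c = ((∑ i, ‖c i‖ ^ 2 : ℝ) : 𝕜) := by
    simp [dotProduct, RCLike.conj_mul]
  have h := hx.posSemidef.re_dotProduct_nonneg c
  rw [add_mulVec, dotProduct_add, star_dotProduct_frameMatrix_mulVec, smul_mulVec, one_mulVec,
    dotProduct_smul, hone, map_add, RCLike.smul_re, RCLike.ofReal_re, RCLike.ofReal_re] at h
  simp only [Function.comp_apply] at h
  linarith

end BarrierSelection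

section L2Selection

variable {Ω 𝕜 : Type*} [RCLike 𝕜] [MeasurableSpace Ω] {μ : Measure Ω}

section Orthonormal

variable {n : Type*} [Fintype n] {e : n → Lp 𝕜 2 μ}

theorem dotProduct_mulVec_star_eq_sum_inner (B : Matrix n n 𝕜) (x : Ω) :
    (e · x) ⬝ᵥ (B *ᵥ star (e · x)) = ∑ i, ∑ j, B i j * inner 𝕜 (e j x) (e i x) := by
  simp only [dotProduct, mulVec, Finset.mul_sum, Pi.star_apply, RCLike.inner_apply,
    RCLike.star_def]
  exact Finset.sum_congr rfl fun i _ => Finset.sum_congr rfl fun j _ => by ring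

theorem integrable_dotProduct_mulVec_star (B : Matrix n n 𝕜) :
    Integrable (fun x => (e · x) ⬝ᵥ (B *ᵥ star (e · x))) μ := by
  simp only [dotProduct_mulVec_star_eq_sum_inner]
  exact integrable_finsetSum _ fun i _ => integrable_finsetSum _ fun j _ =>
    (L2.integrable_inner (e j) (e i)).const_mul _

theorem integral_dotProduct_mulVec_star (he : Orthonormal 𝕜 e) (B : Matrix n n 𝕜) :
    ∫ x, (e · x) ⬝ᵥ (B *ᵥ star (e · x)) ∂μ = B.trace := by
  classical
  have hint (i j : n) : Integrable (fun x => B i j * inner 𝕜 (e j x) (e i x)) μ :=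
    (L2.integrable_inner (e j) (e i)).const_mul _
  simp only [dotProduct_mulVec_star_eq_sum_inner]
  rw [integral_finsetSum _ fun i _ => integrable_finsetSum _ fun j _ => hint i j]
  simp only [integral_finsetSum _ fun j _ => hint _ j, integral_const_mul, ← L2.inner_def,
    orthonormal_iff_ite.1 he, mul_ite, mul_one, mul_zero, Finset.sum_ite_eq', Finset.mem_univ,
    if_true, trace, diag_apply]

theorem exists_re_trace_le [IsProbabilityMeasure μ] (he : Orthonormal 𝕜 e) {p : Ω → Prop}
    (hp : ∀ᵐ x ∂μ, p x) (B : Matrix n n 𝕜) :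
    ∃ x : {x // p x}, RCLike.re B.trace ≤ RCLike.re ((e · x) ⬝ᵥ (B *ᵥ star (e · x))) := by
  obtain ⟨x, hx, hle⟩ := exists_notMem_null_integral_le
    (integrable_dotProduct_mulVec_star (e := e) B).re (ae_iff.1 hp)
  rw [integral_re (integrable_dotProduct_mulVec_star B), integral_dotProduct_mulVec_star he] at hle
  exact ⟨⟨x, not_not.1 hx⟩, hle⟩

end Orthonormal

theorem integral_norm_sq_eq_norm_toLp_sq {f : Ω → 𝕜} (hf : MemLp f 2 μ) :
    ∫ x, ‖f x‖ ^ 2 ∂μ = ‖hf.toLp f‖ ^ 2 := by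
  refine RCLike.ofReal_injective (K := 𝕜) ?_
  rw [RCLike.ofReal_pow, ← inner_self_eq_norm_sq_to_K (𝕜 := 𝕜), L2.inner_def, ← integral_ofReal]
  refine integral_congr_ae ?_
  filter_upwards [hf.coeFn_toLp] with x hx
  rw [hx, inner_self_eq_norm_sq_to_K, RCLike.ofReal_pow]

theorem ae_forall_linearMap_apply_eq {V : Type*} [AddCommGroup V] [Module 𝕜 V] [Module.Finite 𝕜 V]
    {S T : V →ₗ[𝕜] Ω → 𝕜} (h : ∀ v, S v =ᵐ[μ] T v) : ∀ᵐ x ∂μ, ∀ v, S v x = T v x := by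
  let b := Module.finBasis 𝕜 V
  filter_upwards [ae_all_iff.2 fun i => h (b i)] with x hx v
  exact LinearMap.congr_fun
    (b.ext hx : LinearMap.proj (φ := fun _ => 𝕜) x ∘ₗ S = LinearMap.proj x ∘ₗ T) v

theorem exists_orthonormal_sum_inner_smul_eq {V E : Type*} [AddCommGroup V] [Module 𝕜 V]
    [Module.Finite 𝕜 V] [NormedAddCommGroup E] [InnerProductSpace 𝕜 E] (T : V →ₗ[𝕜] E) :
    ∃ n ≤ Module.finrank 𝕜 V, ∃ e : Fin n → E, Orthonormal 𝕜 e ∧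
      ∀ v, ∑ i, inner 𝕜 (e i) (T v) • e i = T v ∧ ∑ i, ‖inner 𝕜 (e i) (T v)‖ ^ 2 = ‖T v‖ ^ 2 := by
  let b := stdOrthonormalBasis 𝕜 T.range
  refine ⟨_, T.finrank_range_le, fun i => b i,
    b.orthonormal.comp_linearIsometry T.range.subtypeₗᵢ, fun v =>
    ⟨?_, b.sum_sq_norm_inner_right ⟨T v, T.mem_range_self v⟩⟩⟩
  simpa using congrArg T.range.subtype (b.sum_repr' ⟨T v, T.mem_range_self v⟩)

theorem exists_orthonormal_ae_forall_eq (X : Submodule 𝕜 (Ω → 𝕜)) [Module.Finite 𝕜 X]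
    (hX : ∀ f ∈ X, MemLp f 2 μ) :
    ∃ n ≤ Module.finrank 𝕜 X, ∃ (e : Fin n → Lp 𝕜 2 μ) (c : X → Fin n → 𝕜), Orthonormal 𝕜 e ∧
      (∀ f : X, ∑ i, ‖c f i‖ ^ 2 = ∫ y, ‖(f : Ω → 𝕜) y‖ ^ 2 ∂μ) ∧
      ∀ᵐ x ∂μ, ∀ f : X, (e · x) ⬝ᵥ c f = (f : Ω → 𝕜) x := by
  let T : X →ₗ[𝕜] Lp 𝕜 2 μ :=
    { toFun f := (hX f f.2).toLp f
      map_add' f g := (hX f f.2).toLp_add (hX g g.2)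
      map_smul' r f := (hX f f.2).toLp_const_smul r }
  obtain ⟨n, hn, e, he, hT⟩ := exists_orthonormal_sum_inner_smul_eq T
  refine ⟨n, hn, e, fun f i => inner 𝕜 (e i) (T f), he,
    fun f => (hT f).2.trans (integral_norm_sq_eq_norm_toLp_sq (hX f f.2)).symm, ?_⟩
  let S : X →ₗ[𝕜] Ω → 𝕜 := ∑ i, (innerₛₗ 𝕜 (e i) ∘ₗ T).smulRight ⇑(e i)
  have hS (f : X) : S f =ᵐ[μ] X.subtype f := by
    have hTf : (T f : Ω → 𝕜) =ᵐ[μ] f := (hX f f.2).coeFn_toLp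
    rw [← (hT f).1] at hTf
    filter_upwards [hTf, Lp.coeFn_fun_finsetSum Finset.univ fun i => inner 𝕜 (e i) (T f) • e i,
      ae_all_iff.2 fun i => Lp.coeFn_smul (inner 𝕜 (e i) (T f)) (e i)] with x hx hsum hsmul
    simpa [S, hsmul] using hsum.symm.trans hx
  filter_upwards [ae_forall_linearMap_apply_eq hS] with x hx f
  rw [← X.subtype_apply, ← hx]
  simp [S, dotProduct, mul_comm]

theorem exists_points_mul_integral_norm_sq_le [IsProbabilityMeasure μ]
    (X : Submodule 𝕜 (Ω → 𝕜)) [Module.Finite 𝕜 X] (hX : ∀ f ∈ X, MemLp f 2 μ) {t : ℝ} (ht : 0 < t)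
    (hcard : Module.finrank 𝕜 X ≤ t) (m : ℕ) :
    ∃ x : Fin m → Ω, ∀ f ∈ X,
      (m / 2 - t) * ∫ y, ‖f y‖ ^ 2 ∂μ ≤ ∑ j, ‖f (x j)‖ ^ 2 := by
  obtain ⟨n, hn, e, c, he, hc, hae⟩ := exists_orthonormal_ae_forall_eq X hX
  have hnt : (Fintype.card (Fin n) : ℝ) ≤ t := by
    rw [Fintype.card_fin]
    exact (Nat.cast_le.2 hn).trans hcard
  obtain ⟨x, hx⟩ := exists_points_mul_sum_norm_sq_le
    (fun B _ => exists_re_trace_le he hae B) ht hnt m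
  refine ⟨fun j => x j, fun f hf => ?_⟩
  simpa only [hc, (x _).2 ⟨f, hf⟩] using hx (c ⟨f, hf⟩)

end L2Selection

section LuxemburgNorm

variable {p : ℝ} {a T : ℝ≥0} {Φ : ℝ≥0 → ℝ≥0}

theorem AIncWith.le_mul_div_rpow (h : AIncWith p a Φ) (hΦ : Φ 0 = 0) {t : ℝ≥0} (htT : t ≤ T) :
    Φ t ≤ a * Φ T * (t / T) ^ p := by
  rcases eq_or_ne t 0 with rfl | ht
  · exact hΦ.trans_le zero_le
  have ht0 : 0 < t := pos_iff_ne_zero.2 ht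
  have hle : Φ t * t ^ (-p) ≤ a * (Φ T * T ^ (-p)) := by
    rcases htT.eq_or_lt with rfl | hlt
    · exact le_mul_of_one_le_left zero_le h.1
    · exact h.2 t T ht0 hlt
  rw [NNReal.rpow_neg, NNReal.rpow_neg, ← div_eq_mul_inv, div_le_iff₀ (NNReal.rpow_pos ht0)] at hle
  rw [NNReal.div_rpow]
  exact hle.trans_eq (by ring)

theorem AIncWith.map_div_le (h : AIncWith p a Φ) (hp : 2 ≤ p) (hΦ : Φ 0 = 0) {s r : ℝ≥0}
    (hr : 1 ≤ r) (hs : s ≤ T) : Φ (s / r) ≤ a * (Φ T / T ^ 2) / r ^ p * s ^ 2 := by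
  have hpow : (s / T) ^ p ≤ (s / T) ^ 2 := by
    rcases (zero_le : 0 ≤ s / T).eq_or_lt with h0 | hpos
    · rw [← h0, NNReal.zero_rpow (by positivity)]
      exact zero_le
    · rw [← NNReal.rpow_two]
      exact NNReal.rpow_le_rpow_of_exponent_ge hpos (div_le_one_of_le₀ hs zero_le) hp
  calc Φ (s / r) ≤ a * Φ T * (s / r / T) ^ p :=
        h.le_mul_div_rpow hΦ ((div_le_self zero_le hr).trans hs)
    _ = a * Φ T * ((s / T) ^ p / r ^ p) := by rw [div_right_comm, NNReal.div_rpow]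
    _ ≤ a * Φ T * ((s / T) ^ 2 / r ^ p) := by gcongr
    _ = _ := by ring

/-- The dilation constant by which `Φ` falls below `s ↦ s²` on `[0, T]`. For `T = √N` it is the
constant `c₂(Φ, p) (Φ(√N) / N)^(1/p)` of the theorem with `C = 1`. -/
noncomputable def luxemburgConst (p : ℝ) (a : ℝ≥0) (Φ : ℝ≥0 → ℝ≥0) (T : ℝ≥0) : ℝ≥0 :=
  a ^ (2 / p) * (1 + (Φ 1)⁻¹) ^ (1 / p) * (Φ T / T ^ 2) ^ (1 / p)

theorem luxemburgConst_rpow (hp : p ≠ 0) :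
    luxemburgConst p a Φ T ^ p = a ^ 2 * (1 + (Φ 1)⁻¹) * (Φ T / T ^ 2) := by
  simp only [luxemburgConst, NNReal.mul_rpow, ← NNReal.rpow_mul, div_mul_cancel₀ _ hp,
    NNReal.rpow_one, NNReal.rpow_two]

theorem AIncWith.one_le_luxemburgConst (h : AIncWith p a Φ) (hp : 2 ≤ p) (hΦ : Φ 0 = 0)
    (hΦ1 : 0 < Φ 1) (hT : 1 ≤ T) : 1 ≤ luxemburgConst p a Φ T := by
  have hp0 : 0 < p := by positivity
  have hmap_one : Φ 1 ≤ a * (Φ T / T ^ 2) := by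
    simpa using h.map_div_le hp hΦ le_rfl hT
  rw [← NNReal.rpow_le_rpow_iff hp0, NNReal.one_rpow, luxemburgConst_rpow hp0.ne']
  calc 1 ≤ Φ 1 + 1 := le_add_self
    _ = 1 * (1 + (Φ 1)⁻¹) * Φ 1 := by field_simp
    _ ≤ a * (1 + (Φ 1)⁻¹) * (a * (Φ T / T ^ 2)) := by gcongr; exact h.1
    _ = _ := by ring

theorem AIncWith.map_div_luxemburgConst_le (h : AIncWith p a Φ) (hp : 2 ≤ p) (hΦ : Φ 0 = 0)
    (hΦ1 : 0 < Φ 1) (hT : 1 ≤ T) {s : ℝ≥0} (hs : s ≤ T) :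
    Φ (s / luxemburgConst p a Φ T) ≤ s ^ 2 := by
  refine (h.map_div_le hp hΦ (h.one_le_luxemburgConst hp hΦ hΦ1 hT) hs).trans
    (mul_le_of_le_one_left zero_le (div_le_one_of_le₀ ?_ zero_le))
  rw [luxemburgConst_rpow (by positivity)]
  calc a * (Φ T / T ^ 2) ≤ a * (1 + (Φ 1)⁻¹) * (a * (Φ T / T ^ 2)) :=
        le_mul_of_one_le_left zero_le (one_le_mul h.1 le_self_add)
    _ = _ := by ring

variable {α E : Type*} [MeasurableSpace α] [NormedAddCommGroup E] [NormedSpace ℝ E]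
  {μ : Measure α} {f : α → E}

theorem luxemburgNorm_le_of_orliczModular_le {r : ℝ≥0} (hr : 0 < r)
    (h : orliczModular Φ μ (fun x => (r : ℝ)⁻¹ • f x) ≤ 1) : luxemburgNorm Φ μ f ≤ r :=
  (iInf_le _ r).trans ((iInf_le _ hr).trans (iInf_le _ h))

theorem luxemburgNorm_eq_zero_of_forall (hΦ : Φ 0 = 0) (hf : ∀ x, f x = 0) :
    luxemburgNorm Φ μ f = 0 := by
  refine le_antisymm (ENNReal.le_of_forall_pos_le_add fun ε hε _ => ?_) zero_le
  rw [zero_add]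
  exact luxemburgNorm_le_of_orliczModular_le hε (by simp [orliczModular, hf, hΦ])

theorem luxemburgNorm_le_mul {r K : ℝ≥0} (hr : 0 < r) (hΦ : ∀ s ≤ T, Φ (s / r) ≤ s ^ 2)
    (hsup : ∀ x, ‖f x‖₊ ≤ K * T) (hL2 : ∫⁻ x, (‖f x‖₊ : ℝ≥0∞) ^ 2 ∂μ ≤ (K : ℝ≥0∞) ^ 2) :
    luxemburgNorm Φ μ f ≤ (r * K : ℝ≥0) := by
  rcases eq_or_ne K 0 with rfl | hK
  · have hΦ0 : Φ 0 = 0 := by simpa using hΦ 0 zero_le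
    rw [luxemburgNorm_eq_zero_of_forall hΦ0 fun x => by simpa using hsup x]
    exact zero_le
  have hK0 : 0 < K := pos_iff_ne_zero.2 hK
  have hpt (x : α) : (Φ ‖((r * K : ℝ≥0) : ℝ)⁻¹ • f x‖₊ : ℝ≥0∞) ≤
      ((K : ℝ≥0∞) ^ 2)⁻¹ * (‖f x‖₊ : ℝ≥0∞) ^ 2 := by
    have hscale : ‖((r * K : ℝ≥0) : ℝ)⁻¹ • f x‖₊ = ‖f x‖₊ / K / r := by
      rw [nnnorm_smul, nnnorm_inv, NNReal.nnnorm_eq, mul_inv, div_div, div_eq_inv_mul, mul_comm K,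
        mul_inv]
    have hle := hΦ (‖f x‖₊ / K) (by rw [div_le_iff₀ hK0, mul_comm]; exact hsup x)
    rw [hscale, ← ENNReal.coe_pow, ← ENNReal.coe_pow, ← ENNReal.coe_inv (pow_ne_zero 2 hK),
      ← ENNReal.coe_mul, ENNReal.coe_le_coe, ← div_eq_inv_mul, ← div_pow]
    exact hle
  have hK2 : (K : ℝ≥0∞) ^ 2 ≠ 0 := pow_ne_zero 2 (ENNReal.coe_ne_zero.2 hK)
  refine luxemburgNorm_le_of_orliczModular_le (mul_pos hr hK0) ?_
  calc orliczModular Φ μ (fun x => ((r * K : ℝ≥0) : ℝ)⁻¹ • f x)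
      ≤ ∫⁻ x, ((K : ℝ≥0∞) ^ 2)⁻¹ * (‖f x‖₊ : ℝ≥0∞) ^ 2 ∂μ := lintegral_mono hpt
    _ = ((K : ℝ≥0∞) ^ 2)⁻¹ * ∫⁻ x, (‖f x‖₊ : ℝ≥0∞) ^ 2 ∂μ :=
        lintegral_const_mul' _ _ (ENNReal.inv_ne_top.2 hK2)
    _ ≤ ((K : ℝ≥0∞) ^ 2)⁻¹ * (K : ℝ≥0∞) ^ 2 := by gcongr
    _ = 1 := ENNReal.inv_mul_cancel hK2 (ENNReal.pow_ne_top ENNReal.coe_ne_top)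

theorem AIncWith.luxemburgNorm_le (h : AIncWith p a Φ) (hp : 2 ≤ p) (hΦ : Φ 0 = 0) (hΦ1 : 0 < Φ 1)
    (hT : 1 ≤ T) {K : ℝ≥0} (hsup : ∀ x, ‖f x‖₊ ≤ K * T)
    (hL2 : ∫⁻ x, (‖f x‖₊ : ℝ≥0∞) ^ 2 ∂μ ≤ (K : ℝ≥0∞) ^ 2) :
    luxemburgNorm Φ μ f ≤ (luxemburgConst p a Φ T * K : ℝ≥0) :=
  luxemburgNorm_le_mul (zero_lt_one.trans_le (h.one_le_luxemburgConst hp hΦ hΦ1 hT))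
    (fun _ => h.map_div_luxemburgConst_le hp hΦ hΦ1 hT) hsup hL2

end LuxemburgNorm

section Sampling

theorem sum_norm_sq_eq_mul_discreteL2Norm_sq {α E : Type*} [NormedAddCommGroup E] {m : ℕ}
    (x : Fin m → α) (f : α → E) : ∑ j, ‖f (x j)‖ ^ 2 = m * discreteL2Norm x f ^ 2 := by
  rw [discreteL2Norm, Real.sq_sqrt (by positivity)]
  rcases m.eq_zero_or_pos with rfl | hm
  · simp
  · field_simp

theorem sum_append_comp {α M : Type*} [AddCommMonoid M] {k l : ℕ} (x : Fin k → α) (y : Fin l → α)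
    (g : α → M) : ∑ j, g (Fin.append x y j) = ∑ j, g (x j) + ∑ j, g (y j) := by
  simp only [Fin.sum_univ_add, Fin.append_left, Fin.append_right]

theorem lintegral_nnnorm_sq_eq_ofReal_integral {α E : Type*} [MeasurableSpace α]
    [NormedAddCommGroup E] {μ : Measure α} {f : α → E} (hf : Integrable (fun y => ‖f y‖ ^ 2) μ) :
    ∫⁻ y, (‖f y‖₊ : ℝ≥0∞) ^ 2 ∂μ = ENNReal.ofReal (∫ y, ‖f y‖ ^ 2 ∂μ) := by
  rw [ofReal_integral_eq_lintegral_ofReal hf (.of_forall fun y => sq_nonneg _)]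
  simp only [ENNReal.ofReal_pow (norm_nonneg _), ofReal_norm, enorm_eq_nnnorm]

variable {Ω 𝕜 : Type*} [RCLike 𝕜] [TopologicalSpace Ω] [CompactSpace Ω] [MeasurableSpace Ω]
  [OpensMeasurableSpace Ω] (μ : Measure Ω) [IsProbabilityMeasure μ]

theorem exists_points_mul_integral_norm_sq_le_of_continuous (X : Submodule 𝕜 C(Ω, 𝕜))
    [Module.Finite 𝕜 X] {t : ℝ} (ht : 0 < t) (hcard : Module.finrank 𝕜 X ≤ t) (m : ℕ) :
    ∃ x : Fin m → Ω, ∀ f ∈ X, (m / 2 - t) * ∫ y, ‖f y‖ ^ 2 ∂μ ≤ ∑ j, ‖f (x j)‖ ^ 2 := by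
  obtain ⟨x, hx⟩ := exists_points_mul_integral_norm_sq_le (μ := μ)
    (X.map (ContinuousMap.coeFnLinearMap 𝕜)) (by
      rintro _ ⟨f, -, rfl⟩
      exact .of_bound f.continuous.aestronglyMeasurable ‖f‖ (.of_forall f.norm_coe_le_norm))
    ht ((Nat.cast_le.2 (Submodule.finrank_map_le _ X)).trans hcard) m
  exact ⟨x, fun f hf => hx f (Submodule.mem_map_of_mem hf)⟩

theorem exists_points_norm_sq_le_and_integral_le (X : Submodule 𝕜 C(Ω, 𝕜)) {N : ℕ} (hN : 1 ≤ N)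
    (hX : Module.finrank 𝕜 X = N) :
    ∃ x : Fin (6 * N) → Ω, ∀ f ∈ X, (∀ y, ‖f y‖ ^ 2 ≤ ∑ j, ‖f (x j)‖ ^ 2) ∧
      N * ∫ y, ‖f y‖ ^ 2 ∂μ ≤ ∑ j, ‖f (x j)‖ ^ 2 := by
  have : Nonempty Ω := nonempty_of_isProbabilityMeasure μ
  have : Module.Finite 𝕜 X := Module.finite_of_finrank_pos (by omega)
  have hN0 : (0 : ℝ) < N := Nat.cast_pos.2 hN
  obtain ⟨u, hu⟩ := exists_points_norm_sq_le_sum X (m := 2 * N) (by omega)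
  obtain ⟨v, hv⟩ := exists_points_mul_integral_norm_sq_le_of_continuous μ X hN0 (by rw [hX]) (4 * N)
  rw [show 6 * N = 2 * N + 4 * N by ring]
  refine ⟨Fin.append u v, fun f hf => ?_⟩
  rw [sum_append_comp u v (‖f ·‖ ^ 2)]
  have hu0 : 0 ≤ ∑ j, ‖f (u j)‖ ^ 2 := by positivity
  have hv0 : 0 ≤ ∑ j, ‖f (v j)‖ ^ 2 := by positivity
  refine ⟨fun y => ?_, ?_⟩
  · have hy : (2 * N + 1 - N : ℝ) * ‖f y‖ ^ 2 ≤ N * ∑ j, ‖f (u j)‖ ^ 2 := by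
      simpa [hX] using hu f hf y
    refine le_add_of_le_of_nonneg (le_of_mul_le_mul_left ?_ hN0) hv0
    linarith [sq_nonneg ‖f y‖]
  · have hint : (4 * N / 2 - N : ℝ) * ∫ y, ‖f y‖ ^ 2 ∂μ ≤ ∑ j, ‖f (v j)‖ ^ 2 := by
      simpa using hv f hf
    linarith

theorem theorem5p2_general (X : Submodule 𝕜 C(Ω, 𝕜)) {N : ℕ} (hN : 1 ≤ N)
    (hX : Module.finrank 𝕜 X = N) :
    ∃ x : Fin (6 * N) → Ω, ∀ (p : ℝ) (Φ : ℝ≥0 → ℝ≥0) (a : ℝ≥0), 2 ≤ p → Φ 0 = 0 → 0 < Φ 1 →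
      AIncWith p a Φ → ∀ f ∈ X,
        luxemburgNorm Φ μ f ≤
          ENNReal.ofReal
            ((√6 * (a : ℝ) ^ (2 / p) * (1 + ((Φ 1 : ℝ≥0) : ℝ)⁻¹) ^ (1 / p)) *
              (((Φ (NNReal.sqrt N) : ℝ≥0) : ℝ) / N) ^ (1 / p) * discreteL2Norm x f) := by
  obtain ⟨x, hx⟩ := exists_points_norm_sq_le_and_integral_le μ X hN hX
  refine ⟨x, fun p Φ a hp hΦ hΦ1 ha f hf => ?_⟩
  have hN0 : (0 : ℝ) < N := Nat.cast_pos.2 hN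
  have hT : 1 ≤ NNReal.sqrt N := by simpa using hN
  obtain ⟨K, hK⟩ : ∃ K : ℝ≥0, K = √6 * discreteL2Norm x f :=
    ⟨⟨_, mul_nonneg (Real.sqrt_nonneg 6) (Real.sqrt_nonneg _)⟩, rfl⟩
  have hsum : ∑ j, ‖f (x j)‖ ^ 2 = N * (K : ℝ) ^ 2 := by
    rw [sum_norm_sq_eq_mul_discreteL2Norm_sq, hK, mul_pow, Real.sq_sqrt (by positivity)]
    push_cast
    ring
  obtain ⟨hsup, hint⟩ := hx f hf
  rw [hsum] at hsup hint
  have hfK (y : Ω) : ‖f y‖₊ ≤ K * NNReal.sqrt N := by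
    rw [← pow_le_pow_iff_left₀ zero_le zero_le two_ne_zero, mul_pow, NNReal.sq_sqrt, mul_comm]
    exact_mod_cast hsup y
  have hfL2 : ∫⁻ y, (‖f y‖₊ : ℝ≥0∞) ^ 2 ∂μ ≤ (K : ℝ≥0∞) ^ 2 := by
    rw [lintegral_nnnorm_sq_eq_ofReal_integral
      ((f.continuous.norm.pow 2).integrable_of_hasCompactSupport (.of_compactSpace _)),
      ← ENNReal.coe_pow]
    exact ENNReal.ofReal_le_of_le_toReal (le_of_mul_le_mul_left hint hN0)
  refine (ha.luxemburgNorm_le hp hΦ hΦ1 hT hfK hfL2).trans_eq ?_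
  rw [← ENNReal.ofReal_coe_nnreal]
  congr 1
  push_cast [luxemburgConst, NNReal.sq_sqrt, hK]
  ring

end Sampling

theorem theorem5p2 :
    ∃ c₁ : ℝ, 0 < c₁ ∧ ∃ C : ℝ, 1 ≤ C ∧
      ∀ (p : ℝ) (_ : 2 ≤ p) (Φ : ℝ≥0 → ℝ≥0) (_ : IsPhiFunction Φ) (_ : 0 < Φ 1)
        (a : ℝ≥0) (_ : AIncWith p a Φ)
        (𝕜 : Type) [RCLike 𝕜]
        (d : ℕ) (Ω : Set (EuclideanSpace ℝ (Fin d))) (_ : IsCompact Ω)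
        (μ : Measure Ω) [IsProbabilityMeasure μ]
        (N : ℕ) (_ : 1 ≤ N)
        (X : Submodule 𝕜 C(Ω, 𝕜)) (_ : Module.finrank 𝕜 X = N),
        ∃ (m : ℕ) (x : Fin m → Ω), 1 ≤ m ∧ (m : ℝ) ≤ c₁ * N ∧
          ∀ f ∈ X,
            luxemburgNorm Φ μ f ≤
              ENNReal.ofReal
                ((C * (a : ℝ) ^ (2 / p) * (1 + ((Φ 1 : ℝ≥0) : ℝ)⁻¹) ^ (1 / p)) *
                  (((Φ (NNReal.sqrt N) : ℝ≥0) : ℝ) / N) ^ (1 / p) *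
                  discreteL2Norm x f) := by
  refine ⟨6, by positivity, √6, Real.one_le_sqrt.2 (by norm_num), ?_⟩
  intro p hp Φ hΦ hΦ1 a ha 𝕜 _ d Ω hΩ μ _ N hN X hX
  have : CompactSpace Ω := isCompact_iff_compactSpace.1 hΩ
  obtain ⟨x, hx⟩ := theorem5p2_general μ X hN hX
  exact ⟨_, x, by omega, by push_cast; linarith, hx p Φ a hp hΦ.map_zero hΦ1 ha⟩
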